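/- For $d\ge 1$ let $\Omega_d=\{x\in\mathbb R^d: x_i\ge 0 \text{ for all } i,\ x_1+\dots+x_d=1\}$ be the standard simplex, and let $\mathrm{Vol}$ denote $(d-1)$-dimensional volume (the volume in the affine hyperplane containing $\Omega_d$). There are universal constants $c_0,C_0>0$ for which the following holds, and in fact it holds with $c_0=\tfrac14$ and $C_0=300$: there is $d_0\in\mathbb N$ such that for all integers $d\ge d_0$ and all integers $N>C_0^d$, if $q_1,q_2,\dots$ are independent random points, each uniformly distributed on $\Omega_d$, and $Q_N$ is the convex hull of $\{q_1,\dots,q_N\}$, then $$\mathbb E\,\mathrm{Vol}(Q_N)\ \ge\ \bigl(1-e^{-c_0\sqrt d}\bigr)\,\mathrm{Vol}(\Omega_d).$$ -/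

import Mathlib

open MeasureTheory ProbabilityTheory

noncomputable section

/-- The standard simplex `Ω_d = {x ≥ 0 : x₁ + ⋯ + x_d = 1}`, as a subset of Euclidean space `ℝᵈ`
(a convex body of dimension `d - 1` inside its affine hull). -/
def simplexΩ (d : ℕ) : Set (EuclideanSpace ℝ (Fin d)) :=
  {x | (∀ i, 0 ≤ x i) ∧ ∑ i, x i = 1}

/-- `(d - 1)`-dimensional volume on `ℝᵈ`: the Euclidean-normalised Hausdorff measure, which agrees
with Lebesgue measure on every `(d - 1)`-dimensional affine subspace. (Meant for `d ≥ 1`.) -/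
def simplexVol (d : ℕ) : Measure (EuclideanSpace ℝ (Fin d)) := μHE[d - 1]

/-- The convex hull of the first `N` terms `p 0, …, p (N - 1)` of a sequence of points. -/
def hullOfFirst {E : Type*} [AddCommGroup E] [Module ℝ E] (N : ℕ) (p : ℕ → E) : Set E :=
  convexHull ℝ (p '' Set.Iio N)

end

/-!
The volume missed by the hull `Q` of `N` uniform points of the simplex, as a proportion of the total
volume, has expectation the probability that one more uniform point `x` lies outside `Q`.

A uniform point of the simplex is the normalization `g / ∑ gᵢ` of a vector `g` of independent
standard exponential variables (`cond_simplexVol_eq_map_radialProj`). If `x` is the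
normalization of `g`, and the sample points are normalizations of `y₁, …, y_N`, then `x ∈ Q` as soon
as each of the `2ᵈ` boxes of vectors below `g` in some coordinates and above it in the others
contains some `yⱼ` (`radialProj_mem_convexHull`). The box of sign pattern `σ` has exponential
measure `m(g) = ∏ mᵢ(gᵢ)`, where `mᵢ(t)` is the mass of `(0, t]` or of `[t, ∞)`; it is missed with
probability `(1 - m) ^ N ≤ (N m) ^ (-1/2)`. Each `mᵢ(gᵢ)` is uniform on `[0, 1]`, so
`mᵢ(gᵢ) ^ (-1/2)` has mean `2`; by independence the sum over the `2ᵈ` boxes is at most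
`2ᵈ · 2ᵈ / √N` (`lintegral_missing_le`). For `N > 300ᵈ` this is below `4⁻ᵈ ≤ e ^ (-√d / 4)`, for
every `d ≥ 1`.
-/

/-! ### Products of exponential variables -/

theorem lintegral_prod_pi {n : ℕ} (f : Fin n → ℝ → ENNReal) (hf : ∀ i, Measurable (f i))
    (μ : Measure ℝ) [SigmaFinite μ] :
    ∫⁻ x, ∏ i, f i (x i) ∂(Measure.pi fun _ : Fin n => μ) = ∏ i, ∫⁻ t, f i t ∂μ := by
  induction n with
  | zero => simp
  | succ n ih =>
    have hmp := (measurePreserving_piFinSuccAbove (fun _ : Fin (n + 1) => μ) 0).symm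
    rw [hmp.lintegral_map_equiv, Fin.prod_univ_succ, ← ih (fun i => f i.succ) fun i => hf _,
      ← lintegral_prod_mul (hf 0).aemeasurable
        (Finset.measurable_prod _ fun i _ => (hf i.succ).comp (measurable_pi_apply i)).aemeasurable]
    refine lintegral_congr fun x => ?_
    simp [Fin.prod_univ_succ, MeasurableEquiv.piFinSuccAbove, Fin.insertNthEquiv]

theorem pi_withDensity {n : ℕ} {f : ℝ → ENNReal} (hf : Measurable f)
    [SigmaFinite (volume.withDensity f)] :
    Measure.pi (fun _ : Fin n => volume.withDensity f) =
      (volume : Measure (Fin n → ℝ)).withDensity fun x => ∏ i, f (x i) := by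
  refine Measure.pi_eq fun s hs => ?_
  rw [withDensity_apply _ (MeasurableSet.univ_pi hs),
    ← lintegral_indicator (MeasurableSet.univ_pi hs)]
  simp_rw [withDensity_apply _ (hs _), ← lintegral_indicator (hs _)]
  rw [← lintegral_prod_pi (fun i => (s i).indicator f) fun i => hf.indicator (hs i), volume_pi]
  refine lintegral_congr fun x => ?_
  by_cases hx : x ∈ Set.univ.pi s
  · rw [Set.indicator_of_mem hx]
    exact Finset.prod_congr rfl fun i _ => (Set.indicator_of_mem (hx i trivial) _).symm
  · rw [Set.indicator_of_notMem hx]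
    simp only [Set.mem_univ_pi, not_forall] at hx
    obtain ⟨i, hi⟩ := hx
    exact (Finset.prod_eq_zero (Finset.mem_univ i) (Set.indicator_of_notMem hi _)).symm

instance : IsProbabilityMeasure (expMeasure 1) := isProbabilityMeasure_expMeasure one_pos

theorem expMeasure_one_eq : expMeasure 1 = volume.withDensity (exponentialPDF 1) := rfl

theorem measurable_exponentialPDF : Measurable (exponentialPDF 1) := by
  unfold exponentialPDF; fun_prop

theorem expMeasure_ae_pos : ∀ᵐ t ∂expMeasure 1, 0 < t := by
  rw [expMeasure_one_eq, ae_withDensity_iff measurable_exponentialPDF]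
  filter_upwards [compl_mem_ae_iff.2 (measure_singleton (0 : ℝ))] with t ht h
  by_contra! h0
  exact h (exponentialPDF_of_neg (lt_of_le_of_ne h0 ht))

theorem lintegral_expMeasure (f : ℝ → ENNReal) (hf : Measurable f) :
    ∫⁻ t, f t ∂expMeasure 1 = ∫⁻ t in Set.Ioi 0, ENNReal.ofReal (Real.exp (-t)) * f t := by
  rw [expMeasure_one_eq, lintegral_withDensity_eq_lintegral_mul _ measurable_exponentialPDF hf,
    ← lintegral_indicator measurableSet_Ioi]
  refine lintegral_congr_ae ?_
  filter_upwards [compl_mem_ae_iff.2 (measure_singleton (0 : ℝ))] with t ht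
  have ht : t ≠ 0 := ht
  by_cases h : 0 < t
  · simp [Set.indicator, h, exponentialPDF_eq, h.le]
  · have : ¬ 0 ≤ t := fun h' => h (lt_of_le_of_ne h' ht.symm)
    simp [Set.indicator, h, exponentialPDF_eq, this]

theorem expMeasure_Iic {t : ℝ} (ht : 0 < t) :
    expMeasure 1 (Set.Iic t) = ENNReal.ofReal (1 - Real.exp (-t)) := by
  rw [← ofReal_cdf, cdf_expMeasure_eq one_pos]
  simp [ht.le]

theorem expMeasure_Ioc {t : ℝ} (ht : 0 < t) :
    expMeasure 1 (Set.Ioc 0 t) = ENNReal.ofReal (1 - Real.exp (-t)) := by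
  rw [← expMeasure_Iic ht]
  refine measure_congr ?_
  filter_upwards [expMeasure_ae_pos] with s hs
  exact propext ⟨fun h => h.2, fun h => ⟨hs, h⟩⟩

theorem expMeasure_Ici {t : ℝ} (ht : 0 < t) :
    expMeasure 1 (Set.Ici t) = ENNReal.ofReal (Real.exp (-t)) := by
  have : NullSingletonClass (expMeasure 1) :=
    inferInstanceAs (NullSingletonClass (volume.withDensity (exponentialPDF 1)))
  have h1 : expMeasure 1 (Set.Ici t) = expMeasure 1 (Set.Iic t)ᶜ := by
    rw [Set.compl_Iic, measure_congr Ioi_ae_eq_Ici]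
  rw [h1, prob_compl_eq_one_sub measurableSet_Iic, expMeasure_Iic ht, ← ENNReal.ofReal_one,
    ← ENNReal.ofReal_sub _ (by simp [ht.le])]
  simp

theorem lintegral_Ioi_of_hasDerivAt {F f : ℝ → ℝ} {a l : ℝ}
    (hc : ContinuousWithinAt F (Set.Ici a) a)
    (hd : ∀ x ∈ Set.Ioi a, HasDerivAt F (f x) x) (hf : ∀ x ∈ Set.Ioi a, 0 ≤ f x)
    (hl : Filter.Tendsto F Filter.atTop (nhds l)) :
    ∫⁻ x in Set.Ioi a, ENNReal.ofReal (f x) = ENNReal.ofReal (l - F a) := by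
  rw [← integral_Ioi_of_hasDerivAt_of_nonneg hc hd hf hl, ofReal_integral_eq_lintegral_ofReal
    (integrableOn_Ioi_deriv_of_nonneg hc hd hf hl)
    ((ae_restrict_mem measurableSet_Ioi).mono hf)]

theorem measurable_expMeasure_Ioc_rpow :
    Measurable fun t => expMeasure 1 (Set.Ioc 0 t) ^ (-(1 / 2) : ℝ) :=
  (Monotone.measurable fun _ _ h => measure_mono (Set.Ioc_subset_Ioc_right h)).pow_const _

theorem measurable_expMeasure_Ici_rpow :
    Measurable fun t => expMeasure 1 (Set.Ici t) ^ (-(1 / 2) : ℝ) :=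
  (Antitone.measurable fun _ _ h => measure_mono (Set.Ici_subset_Ici.2 h)).pow_const _

/-- The mass `F(t)` below a random exponential `t` is uniform on `[0, 1]`, so `F(t) ^ (-1/2)`
has mean `2`. -/
theorem lintegral_expMeasure_Ioc_rpow :
    ∫⁻ t, expMeasure 1 (Set.Ioc 0 t) ^ (-(1 / 2) : ℝ) ∂expMeasure 1 = 2 := by
  rw [lintegral_expMeasure _ measurable_expMeasure_Ioc_rpow]
  have h := lintegral_Ioi_of_hasDerivAt (a := 0) (l := 2)
    (F := fun t => 2 * (1 - Real.exp (-t)) ^ (1 / 2 : ℝ))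
    (f := fun t => Real.exp (-t) * (1 - Real.exp (-t)) ^ (-(1 / 2) : ℝ)) ?_ ?_ ?_ ?_
  · simp only [neg_zero, Real.exp_zero, sub_self] at h
    rw [Real.zero_rpow (by norm_num), mul_zero, sub_zero] at h
    rw [show (2 : ENNReal) = ENNReal.ofReal 2 by simp, ← h]
    refine setLIntegral_congr_fun measurableSet_Ioi fun t ht => ?_
    have : 0 < 1 - Real.exp (-t) := by simpa using ht
    rw [expMeasure_Ioc ht, ENNReal.ofReal_rpow_of_pos this,
      ENNReal.ofReal_mul (Real.exp_pos _).le]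
  · refine Continuous.continuousWithinAt ?_
    exact continuous_const.mul ((by fun_prop : Continuous fun t : ℝ => 1 - Real.exp (-t)).rpow_const
      fun _ => Or.inr (by norm_num))
  · intro t ht
    have h0 : 0 < 1 - Real.exp (-t) := by simpa using ht
    have h1 : HasDerivAt (fun t : ℝ => 1 - Real.exp (-t)) (Real.exp (-t)) t := by
      simpa using ((hasDerivAt_neg t).exp).const_sub 1
    exact ((h1.rpow_const (p := 1 / 2) (Or.inl h0.ne')).const_mul 2).congr_deriv
      (by norm_num; ring)
  · intro t ht
    have h0 : 0 < 1 - Real.exp (-t) := by simpa using ht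
    positivity
  · have h1 := ((tendsto_const_nhds (x := (1 : ℝ))).sub
      Real.tendsto_exp_neg_atTop_nhds_zero).rpow_const (p := 1 / 2) (Or.inr (by norm_num))
    simpa using h1.const_mul 2

theorem lintegral_expMeasure_Ici_rpow :
    ∫⁻ t, expMeasure 1 (Set.Ici t) ^ (-(1 / 2) : ℝ) ∂expMeasure 1 = 2 := by
  rw [lintegral_expMeasure _ measurable_expMeasure_Ici_rpow]
  have h := lintegral_Ioi_of_hasDerivAt (a := 0) (l := 0)
    (F := fun t => -2 * Real.exp (-(t / 2))) (f := fun t => Real.exp (-(t / 2))) ?_ ?_ ?_ ?_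
  · norm_num at h
    rw [← h]
    refine setLIntegral_congr_fun measurableSet_Ioi fun t ht => ?_
    rw [expMeasure_Ici ht, ENNReal.ofReal_rpow_of_pos (Real.exp_pos _),
      ← ENNReal.ofReal_mul (Real.exp_pos _).le, ← Real.exp_mul, ← Real.exp_add]
    congr 2
    ring
  · exact (by fun_prop : Continuous _).continuousWithinAt
  · intro t ht
    have h1 : HasDerivAt (fun t : ℝ => Real.exp (-(t / 2))) (Real.exp (-(t / 2)) * -(1 / 2)) t := by
      simpa using (((hasDerivAt_id t).div_const 2).neg).exp
    exact (h1.const_mul (-2)).congr_deriv (by ring)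
  · intro t ht
    positivity
  · simpa using (Real.tendsto_exp_neg_atTop_nhds_zero.comp
      (Filter.tendsto_id.atTop_div_const (two_pos : (0 : ℝ) < 2))).const_mul (-2)

/-! ### Hulls of directions -/

/-- The radial projection of a vector to the hyperplane `{x | ∑ i, x i = 1}`
(it is `0` for vectors of coordinate sum `0`). -/
noncomputable def radialProj {d : ℕ} (g : Fin d → ℝ) : EuclideanSpace ℝ (Fin d) :=
  WithLp.toLp 2 ((∑ i, g i)⁻¹ • g)

theorem measurable_radialProj {d : ℕ} : Measurable (radialProj (d := d)) :=
  (WithLp.measurable_toLp 2 _).comp (by fun_prop)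

/-- Points of a fixed sign pattern relative to `g`: in `(0, g i]` in the coordinates where `σ` is
true, and above `g i` in the others. It lies in the positive orthant if `g` does. -/
def signBox {d : ℕ} (g : Fin d → ℝ) (σ : Fin d → Bool) : Set (Fin d → ℝ) :=
  Set.univ.pi fun i => bif σ i then Set.Ioc 0 (g i) else Set.Ici (g i)

theorem measurableSet_signBox {d : ℕ} (g : Fin d → ℝ) (σ : Fin d → Bool) :
    MeasurableSet (signBox g σ) :=
  MeasurableSet.univ_pi fun i => by cases σ i <;> simp

/-- Otherwise some linear form is negative at the projection of `g` and positive at the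
projections of all `y j`, hence negative at `g` and positive at all `y j`. But the point `y j` in
the box below `g` exactly where the form has nonnegative coefficients takes at most the value
at `g`. -/
theorem radialProj_mem_convexHull {d : ℕ} [NeZero d] {ι : Type*} [Finite ι] {g : Fin d → ℝ}
    (hg : ∀ i, 0 < g i) {y : ι → Fin d → ℝ} (hy : ∀ σ, ∃ j, y j ∈ signBox g σ) :
    radialProj g ∈ convexHull ℝ (Set.range fun j => radialProj (y j)) := by
  by_contra hx
  have hne : (Finset.univ : Finset (Fin d)).Nonempty := Finset.univ_nonempty
  obtain ⟨f, u, hfx, hfy⟩ := geometric_hahn_banach_point_closed (convex_convexHull ℝ _)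
    ((Set.finite_range fun j => radialProj (y j)).isCompact_convexHull (𝕜 := ℝ)).isClosed hx
  -- on the hyperplane of coordinate sum `1`, `f - u` is the linear form with coefficients `a i - u`
  let a : Fin d → ℝ := fun i => f (EuclideanSpace.single i 1)
  have hf : ∀ z : Fin d → ℝ, f (radialProj z) = (∑ i, z i)⁻¹ * ∑ i, a i * z i := by
    intro z
    have : radialProj z = ∑ i, ((∑ i, z i)⁻¹ * z i) • EuclideanSpace.single i (1 : ℝ) := by
      ext k
      simp [radialProj, Pi.single_apply]
    rw [this, map_sum, Finset.mul_sum]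
    refine Finset.sum_congr rfl fun i _ => ?_
    simp only [map_smul, smul_eq_mul, a]
    ring
  obtain ⟨j, hj⟩ := hy fun i => decide (u ≤ a i)
  have hj' : ∀ i, 0 < y j i ∧ (a i - u) * y j i ≤ (a i - u) * g i := by
    intro i
    have h := hj i trivial
    by_cases hi : u ≤ a i
    · simp only [hi, decide_true, cond_true, Set.mem_Ioc] at h
      exact ⟨h.1, mul_le_mul_of_nonneg_left h.2 (by linarith)⟩
    · simp only [hi, decide_false, cond_false, Set.mem_Ici] at h
      exact ⟨(hg i).trans_le h, mul_le_mul_of_nonpos_left h (by linarith)⟩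
  have hgs : 0 < ∑ i, g i := Finset.sum_pos (fun i _ => hg i) hne
  have hys : 0 < ∑ i, y j i := Finset.sum_pos (fun i _ => (hj' i).1) hne
  have h1 := hfy _ (subset_convexHull ℝ _ (Set.mem_range_self j))
  rw [hf, inv_mul_eq_div, div_lt_iff₀ hgs] at hfx
  rw [hf, inv_mul_eq_div, lt_div_iff₀ hys] at h1
  have h2 := Finset.sum_le_sum fun i (_ : i ∈ Finset.univ) => (hj' i).2
  simp only [sub_mul, Finset.sum_sub_distrib, ← Finset.mul_sum] at h2
  linarith

/-- The incidence set is the projection of a closed set along the compact simplex of weights. It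
gives the joint measurability needed to exchange the sample with the test point. -/
theorem isClosed_mem_convexHull_range (ι E : Type*) [Fintype ι] [NormedAddCommGroup E]
    [NormedSpace ℝ E] : IsClosed {p : (ι → E) × E | p.2 ∈ convexHull ℝ (Set.range p.1)} := by
  classical
  have : {p : (ι → E) × E | p.2 ∈ convexHull ℝ (Set.range p.1)} =
      Prod.fst '' {z : ((ι → E) × E) × stdSimplex ℝ ι | z.1.2 = ∑ i, z.2.1 i • z.1.1 i} := by
    ext p
    have h : Set.range p.1 =
        (∑ i, (LinearMap.proj (R := ℝ) i).smulRight (p.1 i) : (ι → ℝ) →ₗ[ℝ] E) ''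
        Set.range fun i => Pi.single i (1 : ℝ) := by
      rw [← Set.range_comp]
      congr 1
      ext i
      simp [Pi.single_apply]
    rw [Set.mem_ofPred_eq, h, ← LinearMap.image_convexHull,
      convexHull_rangle_single_eq_stdSimplex]
    constructor
    · rintro ⟨w, hw, hp⟩
      exact ⟨(p, ⟨w, hw⟩), by simpa [LinearMap.sum_apply] using hp.symm, rfl⟩
    · rintro ⟨⟨p', w⟩, hw, rfl⟩
      rw [Set.mem_ofPred_eq] at hw
      exact ⟨w.1, w.2, by rw [hw]; simp [LinearMap.sum_apply]⟩
  have : CompactSpace (stdSimplex ℝ ι) := isCompact_iff_compactSpace.1 (isCompact_stdSimplex ℝ ι)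
  rw [‹{p : (ι → E) × E | _} = _›]
  refine isClosedMap_fst_of_compactSpace _ (isClosed_eq (by fun_prop) ?_)
  exact continuous_finsetSum _ fun i _ =>
    ((continuous_apply i).comp (continuous_subtype_val.comp continuous_snd)).smul
      ((continuous_apply i).comp (continuous_fst.comp continuous_fst))

/-! ### The uniform distribution on the simplex -/

/-- The corner simplex `{w ≥ 0 : w₁ + ⋯ + wₙ ≤ 1}`. -/
def cornerSimplex (n : ℕ) : Set (Fin n → ℝ) := {w | (∀ i, 0 ≤ w i) ∧ ∑ i, w i ≤ 1}

theorem measurableSet_cornerSimplex (n : ℕ) : MeasurableSet (cornerSimplex n) := by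
  have : cornerSimplex n = (⋂ i, {w | 0 ≤ w i}) ∩ {w | ∑ i, w i ≤ 1} := by
    ext w; simp [cornerSimplex]
  rw [this]
  exact (MeasurableSet.iInter fun i =>
    measurableSet_le measurable_const (measurable_pi_apply i)).inter
      (measurableSet_le (by fun_prop) measurable_const)

/-- The affine parametrization of the hyperplane `∑ i, x i = 1` by all coordinates but the zeroth. -/
noncomputable def simplexChart {n : ℕ} (w : Fin n → ℝ) : EuclideanSpace ℝ (Fin (n + 1)) :=
  WithLp.toLp 2 (Fin.cons (1 - ∑ i, w i) w)

theorem measurable_simplexChart {n : ℕ} : Measurable (simplexChart (n := n)) := by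
  refine (WithLp.measurable_toLp 2 _).comp (measurable_pi_iff.2 fun i => ?_)
  refine Fin.cases ?_ (fun i => ?_) i <;> simp <;> fun_prop

theorem simplexChart_mem_simplexΩ {n : ℕ} {w : Fin n → ℝ} :
    simplexChart w ∈ simplexΩ (n + 1) ↔ w ∈ cornerSimplex n := by
  simp [simplexΩ, cornerSimplex, simplexChart, Fin.forall_fin_succ, Fin.sum_univ_succ, and_comm]

theorem measurableSet_simplexΩ (d : ℕ) : MeasurableSet (simplexΩ d) := by
  have : simplexΩ d = (⋂ i, {x | 0 ≤ x i}) ∩ {x | ∑ i, x i = 1} := by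
    ext w; simp [simplexΩ]
  rw [this]
  exact (MeasurableSet.iInter fun i => measurableSet_le measurable_const (by fun_prop)).inter
    (measurableSet_eq_fun (by fun_prop) measurable_const)

theorem lintegral_comp_smul_pi {n : ℕ} {f : (Fin n → ℝ) → ENNReal} (hf : Measurable f) {s : ℝ}
    (hs : 0 < s) : ∫⁻ z, f z = ENNReal.ofReal (s ^ n) * ∫⁻ w, f (s • w) := by
  rw [← lintegral_map hf (measurable_const_smul s), Measure.map_addHaar_smul _ hs.ne',
    lintegral_smul_measure, smul_eq_mul, ← mul_assoc, ← ENNReal.ofReal_mul (by positivity),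
    abs_of_pos (by positivity)]
  simp [hs.ne']

theorem prod_exponentialPDF {n : ℕ} (g : Fin n → ℝ) :
    ∏ i, exponentialPDF 1 (g i) =
      {g : Fin n → ℝ | ∀ i, 0 ≤ g i}.indicator (fun g => ENNReal.ofReal (Real.exp (-∑ i, g i))) g := by
  simp_rw [exponentialPDF_eq]
  by_cases h : ∀ i, 0 ≤ g i
  · rw [Set.indicator_of_mem (by exact h), ← Finset.sum_neg_distrib, Real.exp_sum,
      ENNReal.ofReal_prod_of_nonneg fun i _ => (Real.exp_pos _).le]
    simp [h]
  · rw [Set.indicator_of_notMem (by exact h)]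
    push Not at h
    obtain ⟨i, hi⟩ := h
    exact Finset.prod_eq_zero (Finset.mem_univ i) (by simp [not_le.2 hi])

/-- Integration in polar coordinates: a function of the direction of an exponential vector is
averaged over the simplex, since the joint density depends on the coordinate sum only. -/
theorem lintegral_radialProj_pi_expMeasure (n : ℕ) {G : EuclideanSpace ℝ (Fin (n + 1)) → ENNReal}
    (hG : Measurable G) :
    ∫⁻ g, G (radialProj g) ∂(Measure.pi fun _ : Fin (n + 1) => expMeasure 1) =
      (∫⁻ s in Set.Ioi (0 : ℝ), ENNReal.ofReal (s ^ n) * ENNReal.ofReal (Real.exp (-s))) *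
        ∫⁻ w in cornerSimplex n, G (simplexChart w) := by
  have hpi : Measure.pi (fun _ : Fin (n + 1) => expMeasure 1) =
      volume.withDensity fun x => ∏ i, exponentialPDF 1 (x i) := by
    have : SigmaFinite (volume.withDensity (exponentialPDF 1)) := by
      rw [← expMeasure_one_eq]; infer_instance
    rw [expMeasure_one_eq]
    exact pi_withDensity measurable_exponentialPDF
  have hm : Measurable fun x : Fin (n + 1) → ℝ => ∏ i, exponentialPDF 1 (x i) :=
    Finset.measurable_prod _ fun i _ => measurable_exponentialPDF.comp (measurable_pi_apply i)
  set f : (Fin (n + 1) → ℝ) → ENNReal :=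
    fun g => (∏ i, exponentialPDF 1 (g i)) * G (radialProj g) with hf
  have hfm : Measurable f := hm.mul (hG.comp measurable_radialProj)
  rw [hpi]
  refine (lintegral_withDensity_eq_lintegral_mul _ hm (hG.comp measurable_radialProj)).trans ?_
  change ∫⁻ g, f g = _
  have hcons : Measurable fun p : ℝ × (Fin n → ℝ) => (Fin.cons p.1 p.2 : Fin (n + 1) → ℝ) := by
    refine measurable_pi_iff.2 fun i => ?_
    refine Fin.cases ?_ (fun i => ?_) i <;> simp <;> fun_prop
  have h1 : ∫⁻ g, f g = ∫⁻ p : ℝ × (Fin n → ℝ), f (Fin.cons p.1 p.2) := by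
    rw [(volume_preserving_piFinSuccAbove (fun _ : Fin (n + 1) => ℝ) 0).symm.lintegral_map_equiv f]
    refine lintegral_congr fun p => ?_
    simp [MeasurableEquiv.piFinSuccAbove, Fin.insertNthEquiv]
  -- the coordinate sum `s` replaces the zeroth coordinate
  have h2 : ∫⁻ p : ℝ × (Fin n → ℝ), f (Fin.cons p.1 p.2) =
      ∫⁻ s : ℝ, ∫⁻ z : Fin n → ℝ, f (Fin.cons (s - ∑ i, z i) z) := by
    rw [Measure.volume_eq_prod,
      lintegral_prod_symm (fun p : ℝ × (Fin n → ℝ) => f (Fin.cons p.1 p.2)) (hfm.comp hcons).aemeasurable]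
    refine Eq.trans (lintegral_congr fun z => ?_) (lintegral_lintegral_swap
      (f := fun (z : Fin n → ℝ) (s : ℝ) => f (Fin.cons (s - ∑ i, z i) z)) ?_)
    · exact (lintegral_sub_right_eq_self (fun t => f (Fin.cons t z)) _).symm
    · have h : Measurable fun p : (Fin n → ℝ) × ℝ => (p.2 - ∑ i, p.1 i, p.1) := by fun_prop
      exact (hfm.comp (hcons.comp h)).aemeasurable
  -- the density is a function of the sum `s` on the orthant, whose slice is `s • cornerSimplex n`
  have hI : ∀ z : Fin n → ℝ, ∀ s : ℝ, f (Fin.cons (s - ∑ i, z i) z) =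
      {z : Fin n → ℝ | (∀ i, 0 ≤ z i) ∧ ∑ i, z i ≤ s}.indicator
        (fun z => ENNReal.ofReal (Real.exp (-s)) * G (WithLp.toLp 2 (s⁻¹ • Fin.cons (s - ∑ i, z i) z))) z := by
    intro z s
    have hsum : ∑ i, (Fin.cons (s - ∑ i, z i) z : Fin (n + 1) → ℝ) i = s := by
      simp [Fin.sum_univ_succ]
    simp only [hf, prod_exponentialPDF, radialProj, hsum]
    simp only [Set.indicator, Set.mem_ofPred_eq, Fin.forall_fin_succ, Fin.cons_zero, Fin.cons_succ,
      sub_nonneg, hsum, ite_mul, zero_mul, and_comm]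
  rw [h1, h2, ← lintegral_mul_const _ (by fun_prop), ← lintegral_indicator measurableSet_Ioi]
  refine lintegral_congr_ae ?_
  filter_upwards [compl_mem_ae_iff.2 (measure_singleton (0 : ℝ))] with s hs0
  have hs0 : s ≠ 0 := hs0
  by_cases hs : 0 < s
  · have h : Measurable fun z : Fin n → ℝ => (s - ∑ i, z i, z) := by fun_prop
    rw [Set.indicator_of_mem (Set.mem_Ioi.2 hs),
      lintegral_comp_smul_pi (f := fun z => f (Fin.cons (s - ∑ i, z i) z))
        (hfm.comp (hcons.comp h)) hs, mul_assoc,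
      ← lintegral_const_mul (f := fun w => G (simplexChart w)) _ (hG.comp measurable_simplexChart),
      ← lintegral_indicator (measurableSet_cornerSimplex n)]
    congr 1
    refine lintegral_congr fun w => ?_
    simp only [hI]
    have hw : (s • w ∈ {z : Fin n → ℝ | (∀ i, 0 ≤ z i) ∧ ∑ i, z i ≤ s}) ↔ w ∈ cornerSimplex n := by
      simp only [Set.mem_ofPred_eq, cornerSimplex, Pi.smul_apply, smul_eq_mul, ← Finset.mul_sum,
        mul_nonneg_iff_of_pos_left hs, mul_le_iff_le_one_right hs]
    have hv : WithLp.toLp 2 (s⁻¹ • Fin.cons (s - ∑ i, (s • w) i) (s • w)) = simplexChart w := by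
      rw [simplexChart]
      congr 1
      ext i
      refine Fin.cases ?_ (fun i => ?_) i
      · simp [← Finset.mul_sum]; field_simp
      · simp [hs0]
    by_cases h' : w ∈ cornerSimplex n
    · simp only [Set.indicator_of_mem h', Set.indicator_of_mem (hw.2 h'), hv]
    · simp only [Set.indicator_of_notMem h', Set.indicator_of_notMem (mt hw.1 h')]
  · rw [Set.indicator_of_notMem (by exact hs)]
    simp only [hI]
    rw [lintegral_eq_zero_of_ae_eq_zero]
    refine Filter.Eventually.of_forall fun z => Set.indicator_of_notMem ?_ _
    rintro ⟨h3, h4⟩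
    exact hs (lt_of_le_of_ne ((Finset.sum_nonneg fun i _ => h3 i).trans h4) hs0.symm)

/-- Surface measure on the simplex is proportional to Lebesgue measure in the chart, by uniqueness
of Haar measure on the direction of the hyperplane. -/
theorem exists_simplexVol_restrict_eq (n : ℕ) : ∃ c : ENNReal, c ≠ 0 ∧ c ≠ ⊤ ∧
    (simplexVol (n + 1)).restrict (simplexΩ (n + 1)) =
      c • (volume.restrict (cornerSimplex n)).map simplexChart := by
  let L : (Fin n → ℝ) →ₗ[ℝ] EuclideanSpace ℝ (Fin (n + 1)) :=
    { toFun := fun w => WithLp.toLp 2 (Fin.cons (-∑ i, w i) w)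
      map_add' := fun v w => by
        ext i
        refine Fin.cases ?_ (fun i => ?_) i <;> simp [Finset.sum_add_distrib, add_comm]
      map_smul' := fun r w => by
        ext i
        refine Fin.cases ?_ (fun i => ?_) i <;> simp [Finset.mul_sum] }
  have hL : Function.Injective L := fun v w h => by
    ext i
    have := congrArg (fun x : EuclideanSpace ℝ (Fin (n + 1)) => x i.succ) h
    simpa [L] using this
  let W := LinearMap.range L
  let e : (Fin n → ℝ) ≃ₗ[ℝ] W := LinearEquiv.ofInjective L hL
  have hfr : Module.finrank ℝ W = n := by simpa using e.finrank_eq.symm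
  have hH : (μHE[n] : Measure W).IsAddHaarMeasure := by
    have := isAddHaarMeasure_euclideanHausdorffMeasure (E := W)
    rwa [hfr] at this
  have hV : ((volume : Measure (Fin n → ℝ)).map e).IsAddHaarMeasure :=
    e.toContinuousLinearEquiv.isAddHaarMeasure_map _
  have heq := Measure.isAddLeftInvariant_eq_smul (μHE[n] : Measure W)
    ((volume : Measure (Fin n → ℝ)).map e)
  set c := Measure.addHaarScalarFactor (μHE[n] : Measure W)
    ((volume : Measure (Fin n → ℝ)).map e)
  have hc : c ≠ 0 := by
    intro h0
    rw [h0, zero_smul] at heq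
    exact NeZero.ne (μHE[n] : Measure W) heq
  let ι : W → EuclideanSpace ℝ (Fin (n + 1)) := fun w =>
    simplexChart (n := n) 0 + (w : EuclideanSpace ℝ (Fin (n + 1)))
  have hι : Isometry ι := (IsometryEquiv.addLeft (simplexChart (n := n) 0)).isometry.comp
    isometry_subtype_coe
  have hιe : ∀ w, ι (e w) = simplexChart w := by
    intro w
    change simplexChart 0 + L w = _
    ext i
    refine Fin.cases ?_ (fun i => ?_) i <;> simp [L, simplexChart, sub_eq_add_neg]
  have hem : Measurable e := e.toLinearMap.continuous_of_finiteDimensional.measurable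
  have hr := hι.map_euclideanHausdorffMeasure (d := n)
  have hΩ := measurableSet_simplexΩ (n + 1)
  have hsub : simplexΩ (n + 1) ⊆ Set.range ι := by
    intro x hx
    refine ⟨e fun i => x i.succ, ?_⟩
    rw [hιe]
    have h1 := hx.2
    rw [Fin.sum_univ_succ] at h1
    ext i
    refine Fin.cases ?_ (fun i => ?_) i <;> simp [simplexChart]
    linarith
  refine ⟨c, by simpa using hc, ENNReal.coe_ne_top, ?_⟩
  have hpre : simplexChart ⁻¹' simplexΩ (n + 1) = cornerSimplex n :=
    Set.ext fun w => simplexChart_mem_simplexΩ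
  have h3 : (simplexVol (n + 1)).restrict (Set.range ι) =
      (c : ENNReal) • (volume : Measure (Fin n → ℝ)).map simplexChart := by
    change (μHE[n + 1 - 1]).restrict _ = _
    rw [Nat.add_sub_cancel, ← hr, heq]
    change ((c : ENNReal) • Measure.map e volume).map ι = _
    rw [Measure.map_smul, Measure.map_map hι.continuous.measurable hem]
    congr 2
    exact funext hιe
  rw [← Set.inter_eq_self_of_subset_left hsub, ← Measure.restrict_restrict hΩ, h3,
    Measure.restrict_smul, Measure.restrict_map measurable_simplexChart hΩ, hpre]

/-- A uniform point of the simplex is the normalization of a vector of independent exponential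
variables. -/
theorem cond_simplexVol_eq_map_radialProj (d : ℕ) [NeZero d] :
    simplexVol d (simplexΩ d) ≠ 0 ∧ simplexVol d (simplexΩ d) ≠ ⊤ ∧
    (simplexVol d)[|simplexΩ d] =
      (Measure.pi fun _ : Fin d => expMeasure 1).map radialProj := by
  obtain ⟨n, rfl⟩ := Nat.exists_eq_succ_of_ne_zero (NeZero.ne d)
  obtain ⟨c, hc0, hct, hc⟩ := exists_simplexVol_restrict_eq n
  set C := ∫⁻ s in Set.Ioi (0 : ℝ), ENNReal.ofReal (s ^ n) * ENNReal.ofReal (Real.exp (-s))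
  have hm : (Measure.pi fun _ : Fin (n + 1) => expMeasure 1).map radialProj =
      (C / c) • (simplexVol (n + 1)).restrict (simplexΩ (n + 1)) := by
    ext B hB
    have h := lintegral_radialProj_pi_expMeasure n (measurable_one.indicator hB)
    rw [← lintegral_map (measurable_one.indicator hB) measurable_radialProj,
      lintegral_indicator_one hB,
      ← lintegral_map (measurable_one.indicator hB) measurable_simplexChart,
      lintegral_indicator_one hB] at h
    rw [h, hc, smul_smul, ENNReal.div_mul_cancel hc0 hct]
    rfl
  have h1 : C / c * simplexVol (n + 1) (simplexΩ (n + 1)) = 1 := by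
    have : IsProbabilityMeasure
        ((Measure.pi fun _ : Fin (n + 1) => expMeasure 1).map radialProj) :=
      Measure.isProbabilityMeasure_map measurable_radialProj.aemeasurable
    have h2 := measure_univ (μ := (Measure.pi fun _ : Fin (n + 1) => expMeasure 1).map radialProj)
    rw [hm] at h2
    simpa using h2
  have h0 : simplexVol (n + 1) (simplexΩ (n + 1)) ≠ 0 := fun h => by simp [h] at h1
  have ht : simplexVol (n + 1) (simplexΩ (n + 1)) ≠ ⊤ := by
    intro h
    rw [h, ENNReal.mul_top'] at h1
    split_ifs at h1 <;> simp at h1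
  refine ⟨h0, ht, ?_⟩
  rw [Nat.succ_eq_add_one, hm, ENNReal.eq_inv_of_mul_eq_one_left h1]
  rfl

/-! ### The probability of missing a random point -/

/-- A bound on the chance that `N` samples miss a set of mass `m` which is multiplicative in `m`,
so that it splits over the coordinates of a box. -/
theorem one_sub_pow_le_rpow {m : ENNReal} (hm : m ≤ 1) {N : ℕ} (hN : 0 < N) :
    (1 - m) ^ N ≤ (N : ENNReal) ^ (-(1 / 2) : ℝ) * m ^ (-(1 / 2) : ℝ) := by
  have hN' : (0 : ℝ) < N := Nat.cast_pos.2 hN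
  rcases eq_or_ne m 0 with rfl | h0
  · rw [ENNReal.zero_rpow_of_neg (by norm_num), ENNReal.mul_top]
    · exact le_top
    · simp
  obtain ⟨r, hr, rfl⟩ : ∃ r : ℝ, 0 < r ∧ ENNReal.ofReal r = m :=
    ⟨m.toReal, ENNReal.toReal_pos h0 (hm.trans_lt ENNReal.one_lt_top).ne,
      ENNReal.ofReal_toReal (hm.trans_lt ENNReal.one_lt_top).ne⟩
  have hr1 : r ≤ 1 := by simpa using hm
  rw [← ENNReal.ofReal_one, ← ENNReal.ofReal_sub _ hr.le, ← ENNReal.ofReal_natCast,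
    ENNReal.ofReal_rpow_of_pos hN', ENNReal.ofReal_rpow_of_pos hr, ← ENNReal.ofReal_pow (by linarith),
    ← ENNReal.ofReal_mul (by positivity), ← Real.mul_rpow hN'.le hr.le]
  refine ENNReal.ofReal_le_ofReal ?_
  have hu : 0 < N * r := by positivity
  have h1 : (1 - r) ^ N ≤ Real.exp (-(N * r)) := by
    rw [← mul_neg, Real.exp_nat_mul]
    exact pow_le_pow_left₀ (by linarith) (Real.one_sub_le_exp_neg r) N
  refine h1.trans ?_
  rw [Real.rpow_neg hu.le, Real.exp_neg, ← Real.sqrt_eq_rpow]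
  refine inv_anti₀ (Real.sqrt_pos.2 hu) ?_
  have h2 : Real.sqrt (N * r) ≤ N * r + 1 := Real.sqrt_le_iff.2 ⟨by linarith, by nlinarith⟩
  exact h2.trans (Real.add_one_le_exp _)

theorem ae_pos_pi_expMeasure (d : ℕ) :
    ∀ᵐ g ∂(Measure.pi fun _ : Fin d => expMeasure 1), ∀ i, 0 < g i :=
  ae_all_iff.2 fun i =>
    (Measure.tendsto_eval_ae_ae (μ := fun _ : Fin d => expMeasure 1) (i := i)).eventually
      expMeasure_ae_pos

/-- The inverse square root of the exponential mass of one side of a sign box: `(0, t]` if `b` is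
true, `[t, ∞)` otherwise. -/
noncomputable def boxWeight (b : Bool) (t : ℝ) : ENNReal :=
  expMeasure 1 (bif b then Set.Ioc 0 t else Set.Ici t) ^ (-(1 / 2) : ℝ)

theorem measurable_boxWeight (b : Bool) : Measurable (boxWeight b) := by
  cases b
  · exact measurable_expMeasure_Ici_rpow
  · exact measurable_expMeasure_Ioc_rpow

theorem lintegral_boxWeight (b : Bool) : ∫⁻ t, boxWeight b t ∂expMeasure 1 = 2 := by
  cases b
  · exact lintegral_expMeasure_Ici_rpow
  · exact lintegral_expMeasure_Ioc_rpow

theorem measure_signBox_avoid_le {d N : ℕ} (hN : 0 < N) (g : Fin d → ℝ) (σ : Fin d → Bool) :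
    (Measure.pi fun _ : Fin N => Measure.pi fun _ : Fin d => expMeasure 1)
      {y | ∀ j, y j ∉ signBox g σ} ≤
      (N : ENNReal) ^ (-(1 / 2) : ℝ) * ∏ i, boxWeight (σ i) (g i) := by
  have h : {y : Fin N → Fin d → ℝ | ∀ j, y j ∉ signBox g σ} =
      Set.univ.pi fun _ => (signBox g σ)ᶜ := by
    ext y; simp
  rw [h, Measure.pi_pi, Finset.prod_const, Finset.card_univ, Fintype.card_fin,
    prob_compl_eq_one_sub (measurableSet_signBox g σ)]
  refine (one_sub_pow_le_rpow prob_le_one hN).trans_eq ?_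
  rw [signBox, Measure.pi_pi, ← ENNReal.prod_rpow_of_ne_top fun i _ => measure_ne_top _ _]
  rfl

/-- The union bound over all sign boxes; the means of the products of weights factorize. -/
theorem lintegral_missing_le {d N : ℕ} [NeZero d] (hN : 0 < N) :
    ∫⁻ g, (Measure.pi fun _ : Fin N => Measure.pi fun _ : Fin d => expMeasure 1)
      {y | radialProj g ∉ convexHull ℝ (Set.range fun j => radialProj (y j))}
      ∂(Measure.pi fun _ : Fin d => expMeasure 1) ≤ (N : ENNReal) ^ (-(1 / 2) : ℝ) * 4 ^ d := by
  calc
    _ ≤ ∫⁻ g, ∑ σ : Fin d → Bool, (N : ENNReal) ^ (-(1 / 2) : ℝ) * ∏ i, boxWeight (σ i) (g i)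
        ∂(Measure.pi fun _ : Fin d => expMeasure 1) := by
      refine lintegral_mono_ae ?_
      filter_upwards [ae_pos_pi_expMeasure d] with g hg
      refine (measure_mono (t := ⋃ σ, {y | ∀ j, y j ∉ signBox g σ}) fun y hy => ?_).trans
        ((measure_iUnion_fintype_le _ _).trans
          (Finset.sum_le_sum fun σ _ => measure_signBox_avoid_le hN g σ))
      by_contra h
      simp only [Set.mem_iUnion, Set.mem_ofPred_eq, not_exists, not_forall, not_not] at h
      exact hy (radialProj_mem_convexHull hg h)
    _ = (N : ENNReal) ^ (-(1 / 2) : ℝ) * 4 ^ d := by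
      have hm : ∀ σ : Fin d → Bool, Measurable fun g : Fin d → ℝ => ∏ i, boxWeight (σ i) (g i) :=
        fun σ => Finset.measurable_prod _ fun i _ =>
          (measurable_boxWeight _).comp (measurable_pi_apply i)
      rw [lintegral_finsetSum _ fun σ _ => (hm σ).const_mul _]
      simp_rw [lintegral_const_mul _ (hm _),
        lintegral_prod_pi (fun i => boxWeight _) (fun i => measurable_boxWeight _),
        lintegral_boxWeight]
      simp only [Finset.prod_const, Finset.sum_const, Finset.card_univ, Fintype.card_fin,
        Fintype.card_pi, Fintype.card_bool, nsmul_eq_mul]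
      push_cast
      rw [show (4 : ENNReal) = 2 * 2 by norm_num, mul_pow]
      ring

theorem rpow_mul_four_pow_le {d N : ℕ} (hd : 1 ≤ d) (hN : (300 : ℝ) ^ d < N) :
    (N : ℝ) ^ (-(1 / 2) : ℝ) * 4 ^ d ≤ Real.exp (-(1 / 4 : ℝ) * Real.sqrt d) := by
  have hN0 : (0 : ℝ) < N := lt_trans (by positivity) hN
  have h1 : (16 : ℝ) ^ d ≤ Real.sqrt N := by
    refine Real.le_sqrt_of_sq_le ?_
    rw [← pow_mul, mul_comm, pow_mul]
    exact (pow_le_pow_left₀ (by norm_num) (by norm_num) d).trans hN.le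
  have h2 : Real.sqrt d ≤ d := Real.sqrt_le_iff.2 ⟨by positivity, by
    have : (1 : ℝ) ≤ d := by exact_mod_cast hd
    nlinarith⟩
  have h3 : (1 / 4 : ℝ) ≤ Real.exp (-(1 / 4)) := by
    have := Real.add_one_le_exp (-(1 / 4) : ℝ)
    linarith
  calc (N : ℝ) ^ (-(1 / 2) : ℝ) * 4 ^ d = (Real.sqrt N)⁻¹ * 4 ^ d := by
        rw [Real.rpow_neg hN0.le, Real.sqrt_eq_rpow]
    _ ≤ ((16 : ℝ) ^ d)⁻¹ * 4 ^ d := by gcongr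
    _ = (1 / 4) ^ d := by rw [← inv_pow, ← mul_pow]; norm_num
    _ ≤ Real.exp (-(1 / 4)) ^ d := by gcongr
    _ = Real.exp (d * -(1 / 4)) := by rw [Real.exp_nat_mul]
    _ ≤ Real.exp (-(1 / 4 : ℝ) * Real.sqrt d) := Real.exp_le_exp.2 (by linarith)

/-! ### The expected volume -/

theorem hullOfFirst_eq_convexHull_range {E : Type*} [AddCommGroup E] [Module ℝ E] (N : ℕ)
    (p : ℕ → E) : hullOfFirst N p = convexHull ℝ (Set.range fun j : Fin N => p j) := by
  rw [hullOfFirst]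
  congr 1
  ext x
  simp [Fin.exists_iff]

theorem convex_simplexΩ (d : ℕ) : Convex ℝ (simplexΩ d) := by
  intro x hx y hy a b ha hb hab
  refine ⟨fun i => ?_, ?_⟩
  · simpa using add_nonneg (mul_nonneg ha (hx.1 i)) (mul_nonneg hb (hy.1 i))
  · simp [Finset.sum_add_distrib, ← Finset.mul_sum, hx.2, hy.2, hab]

theorem measurableSet_notMem_convexHull_range (d N : ℕ) :
    MeasurableSet {p : (Fin N → EuclideanSpace ℝ (Fin d)) × EuclideanSpace ℝ (Fin d) |
      p.2 ∉ convexHull ℝ (Set.range p.1)} :=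
  (isClosed_mem_convexHull_range (Fin N) (EuclideanSpace ℝ (Fin d))).measurableSet.compl

/-- The expected uncovered proportion of the simplex is the chance that one further uniform point
misses the hull, and all the points may be drawn as normalized exponential vectors. -/
theorem lintegral_cond_compl_convexHull_le {d N : ℕ} [NeZero d] (hN : 0 < N) :
    ∫⁻ p, ((simplexVol d)[|simplexΩ d]) (convexHull ℝ (Set.range p))ᶜ
      ∂(Measure.pi fun _ : Fin N => (simplexVol d)[|simplexΩ d]) ≤
      (N : ENNReal) ^ (-(1 / 2) : ℝ) * 4 ^ d := by
  have hA := measurableSet_notMem_convexHull_range d N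
  have : IsProbabilityMeasure
      ((Measure.pi fun _ : Fin d => expMeasure 1).map radialProj) :=
    Measure.isProbabilityMeasure_map measurable_radialProj.aemeasurable
  rw [(cond_simplexVol_eq_map_radialProj d).2.2]
  refine (Measure.prod_apply hA).symm.trans_le ?_
  rw [Measure.prod_apply_symm hA,
    lintegral_map (measurable_measure_prodMk_right hA) measurable_radialProj]
  refine le_trans (lintegral_mono fun g => ?_) (lintegral_missing_le hN)
  rw [← Measure.pi_map_pi fun _ => measurable_radialProj.aemeasurable, Measure.map_apply]
  · rfl
  · exact measurable_pi_lambda _ fun j => measurable_radialProj.comp (measurable_pi_apply j)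
  · exact measurable_prodMk_right hA

theorem theorem2 :
    ∃ d₀ : ℕ, ∀ d : ℕ, d₀ ≤ d → ∀ N : ℕ, (300 : ℝ) ^ d < (N : ℝ) →
      ∀ {S : Type*} [MeasurableSpace S] (P : Measure S) [IsProbabilityMeasure P]
        (q : ℕ → S → EuclideanSpace ℝ (Fin d)),
        (∀ j, Measurable (q j)) →
        iIndepFun q P →
        (∀ j, pdf.IsUniform (q j) (simplexΩ d) P (simplexVol d)) →
        Integrable (fun s => (simplexVol d).real (hullOfFirst N (fun j => q j s))) P ∧
        (1 - Real.exp (-(1 / 4 : ℝ) * Real.sqrt d)) * (simplexVol d).real (simplexΩ d) ≤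
          ∫ s, (simplexVol d).real (hullOfFirst N (fun j => q j s)) ∂P := by
  refine ⟨1, fun d hd N hN S _ P _ q hqm hqi hqu => ?_⟩
  have : NeZero d := ⟨by omega⟩
  have hN0 : 0 < N := by
    have : (0 : ℝ) < N := lt_trans (by positivity) hN
    exact_mod_cast this
  obtain ⟨hV0, hVt, -⟩ := cond_simplexVol_eq_map_radialProj d
  set μ := (simplexVol d)[|simplexΩ d] with hμ
  have hμp : IsProbabilityMeasure μ := cond_isProbabilityMeasure_of_finite hV0 hVt
  have hΩ := measurableSet_simplexΩ d
  let hull : S → Set (EuclideanSpace ℝ (Fin d)) := fun s => hullOfFirst N fun j => q j s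
  have hhull : ∀ s, hull s = convexHull ℝ (Set.range fun j : Fin N => q j s) :=
    fun s => hullOfFirst_eq_convexHull_range N _
  have hQm : Measurable fun s => fun j : Fin N => q j s :=
    measurable_pi_lambda _ fun j => hqm j
  have hA := measurableSet_notMem_convexHull_range d N
  have hYm : Measurable fun p : Fin N → EuclideanSpace ℝ (Fin d) =>
      μ (convexHull ℝ (Set.range p))ᶜ := measurable_measure_prodMk_left hA
  have hlaw : P.map (fun s => fun j : Fin N => q j s) = Measure.pi fun _ : Fin N => μ := by
    rw [iIndepFun.map_fun_eq_pi_map (fun j : Fin N => (hqm j).aemeasurable)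
      (hqi.precomp Fin.val_injective)]
    congr 1
    exact funext fun j => hqu j
  have hY : ∫⁻ s, μ (hull s)ᶜ ∂P ≤ (N : ENNReal) ^ (-(1 / 2) : ℝ) * 4 ^ d := by
    simp_rw [hhull]
    rw [← lintegral_map hYm hQm, hlaw]
    exact lintegral_cond_compl_convexHull_le hN0
  have hYms : Measurable fun s => μ (hull s)ᶜ := by
    simp_rw [hhull]
    exact hYm.comp hQm
  have hYi : Integrable (fun s => μ.real (hull s)ᶜ) P :=
    Integrable.of_bound hYms.ennreal_toReal.aestronglyMeasurable 1
      (Filter.Eventually.of_forall fun s => by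
      rw [Real.norm_of_nonneg measureReal_nonneg]; exact measureReal_le_one)
  have hmem : ∀ᵐ s ∂P, ∀ j, q j s ∈ simplexΩ d := by
    refine ae_all_iff.2 fun j => ae_of_ae_map (hqm j).aemeasurable ?_
    rw [show P.map (q j) = μ from hqu j]
    exact ae_cond_mem hΩ
  have hvol : (fun s => (simplexVol d).real (hull s)) =ᵐ[P]
      fun s => (simplexVol d).real (simplexΩ d) * (1 - μ.real (hull s)ᶜ) := by
    filter_upwards [hmem] with s hs
    have hsub : hull s ⊆ simplexΩ d := by
      rw [hhull]
      refine convexHull_min ?_ (convex_simplexΩ d)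
      rintro _ ⟨j, rfl⟩
      exact hs j
    have hm : MeasurableSet (hull s) := by
      rw [hhull]
      exact ((Set.finite_range _).isCompact_convexHull (𝕜 := ℝ)).isClosed.measurableSet
    rw [probReal_compl_eq_one_sub hm, sub_sub_cancel, measureReal_def, measureReal_def,
      measureReal_def, hμ, cond_apply hΩ, Set.inter_eq_self_of_subset_right hsub, ← ENNReal.toReal_mul,
      ← mul_assoc, ENNReal.mul_inv_cancel hV0 hVt, one_mul]
  refine ⟨(((integrable_const 1).sub hYi).const_mul _).congr hvol.symm, ?_⟩
  have hfin : (N : ENNReal) ^ (-(1 / 2) : ℝ) * 4 ^ d ≠ ⊤ := by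
    refine ENNReal.mul_ne_top (ENNReal.rpow_ne_top_of_ne_zero ?_ ?_) (by simp)
    · exact_mod_cast hN0.ne'
    · simp
  have hYle : ∫ s, μ.real (hull s)ᶜ ∂P ≤ Real.exp (-(1 / 4 : ℝ) * Real.sqrt d) := by
    refine le_trans ?_ (rpow_mul_four_pow_le hd hN)
    have h := ENNReal.toReal_mono hfin hY
    rw [← integral_toReal hYms.aemeasurable
      (Filter.Eventually.of_forall fun s => measure_lt_top _ _)] at h
    simpa [ENNReal.toReal_mul, ← ENNReal.toReal_rpow, measureReal_def] using h
  rw [integral_congr_ae hvol, integral_const_mul, integral_sub (integrable_const _) hYi, mul_comm]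
  simp only [integral_const, probReal_univ, one_smul]
  gcongr
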